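/- Let $k\in\mathbb N$ and let $(\Lambda,d)$ be a $k$-graph, that is, a countable category $\Lambda$ with a functor $d$ from $\Lambda$ to the monoid $\mathbb N^k$ with the factorisation property: whenever $d(\lambda)=m+n$, there are unique morphisms $\mu,\nu$ with $\lambda=\mu\nu$, $d(\mu)=m$ and $d(\nu)=n$. Morphisms are called paths, $r$ and $s$ denote range (codomain) and source (domain), vertices $v$ are identified with their identity morphisms, the set of vertices is $\Lambda^0$, and $v\Lambda^m=\{\lambda: r(\lambda)=v,\ d(\lambda)=m\}$. For $p\le q\le d(\lambda)$ let $\lambda(p,q)$ be the unique path such that $\lambda=\lambda'\lambda(p,q)\lambda''$ for some $\lambda',\lambda''$ with $d(\lambda')=p$, $d(\lambda(p,q))=q-p$ and $d(\lambda'')=d(\lambda)-q$. Suppose that $\Lambda$ is row-finite with no sources, that is, $0<|v\Lambda^{e_i}|<\infty$ for all $v\in\Lambda^0$ and $1\le i\le k$, where $e_1,\dots,e_k$ are the generators of $\mathbb N^k$. Suppose that $\Lambda$ is aperiodic: for every $v\in\Lambda^0$ and all $m\ne n$ in $\mathbb N^k$ there is a path $\lambda$ with $r(\lambda)=v$, $d(\lambda)\ge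 m\vee n$ and $$\lambda\big(m,m+d(\lambda)-(m\vee n)\big)\ne\lambda\big(n,n+d(\lambda)-(m\vee n)\big).$$ Let $\{t_\lambda:\lambda\in\Lambda\}$ be a Cuntz–Krieger $\Lambda$-family in a $C^*$-algebra $B$, that is, a family of partial isometries such that (CK1) $\{t_v: v\in\Lambda^0\}$ are mutually orthogonal projections; (CK2) $t_{\lambda\mu}=t_\lambda t_\mu$ whenever $s(\lambda)=r(\mu)$; (CK3) $t_\lambda^*t_\lambda=t_{s(\lambda)}$ for all $\lambda$; (CK4) $t_v=\sum_{\lambda\in v\Lambda^m}t_\lambda t_\lambda^*$ for all $v\in\Lambda^0$ and $m\in\mathbb N^k$. Assume that $t_v\ne0$ for all $v\in\Lambda^0$. Let $F$ be a finite set of paths and let $(\mu,\nu)\mapsto a_{\mu,\nu}$ be a $\mathbb C$-valued function on $F\times F$ such that $s(\mu)=s(\nu)$ whenever $a_{\mu,\nu}\ne0$. Then $$\Big\|\sum_{\mu,\nu\in F}a_{\mu,\nu}\,t_\mu t_\nu^*\Big\|\ \ge\ \Big\|\sum_{\mu,\nu\in F,\ d(\mu)=d(\nu)}a_{\mu,\nu}\,t_\mu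 t_\nu^*\Big\|.$$ -/

import Mathlib

open CategoryTheory

universe u v

/-- A `k`-graph: a countable category `Λ` with a degree functor to the monoid `ℕ^k` (written out as
a map on morphisms that sends identities to `0` and compositions to sums) which has the
factorisation property.

A morphism `f : x ⟶ y` is a path with source `x` and range `y`; the product `μν` of paths with
`s(μ) = r(ν)` is the composition `ν ≫ μ`. -/
structure KGraph (k : ℕ) (Λ : Type u) [Category.{v} Λ] where
  /-- the degree of a morphism -/
  deg : ∀ {x y : Λ}, (x ⟶ y) → (Fin k → ℕ)
  countable : Countable (Quiver.Total Λ)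
  deg_id : ∀ x : Λ, deg (𝟙 x) = 0
  deg_comp : ∀ {x y z : Λ} (f : x ⟶ y) (g : y ⟶ z), deg (f ≫ g) = deg g + deg f
  /-- if `d(f) = m + n`, then `f = μν` for unique `μ : w ⟶ y` and `ν : x ⟶ w` with
  `d(μ) = m` and `d(ν) = n` (the vertex `w` is part of the data) -/
  factorisation : ∀ {x y : Λ} (f : x ⟶ y) (m n : Fin k → ℕ), deg f = m + n →
    ∃! p : (w : Λ) × (w ⟶ y) × (x ⟶ w),
      deg p.2.1 = m ∧ deg p.2.2 = n ∧ p.2.2 ≫ p.2.1 = f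

namespace KGraph

/-- The paths of a `k`-graph are all its morphisms: `l.left` is the source of the path `l`,
`l.right` is its range. -/
abbrev Path (Λ : Type u) [Category.{v} Λ] : Type (max u v) := Quiver.Total Λ

/-- The path of a morphism. -/
abbrev path {Λ : Type u} [Category.{v} Λ] {x y : Λ} (f : x ⟶ y) : Path Λ := ⟨x, y, f⟩

variable {k : ℕ} {Λ : Type u} [Category.{v} Λ] (G : KGraph k Λ)

/-- The degree `d(l)` of a path. -/
def d (l : Path Λ) : Fin k → ℕ := G.deg l.hom

/-- The set `vΛ^m` of the paths of degree `m` with range `x = v`. -/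
def pathsInto (x : Λ) (m : Fin k → ℕ) : Set (Path Λ) := {l | l.right = x ∧ G.d l = m}

/-- Every `vΛ^{e_i}` is finite. -/
def RowFinite : Prop := ∀ (x : Λ) (i : Fin k), (G.pathsInto x (Pi.single i 1)).Finite

/-- Every `vΛ^{e_i}` is nonempty. -/
def NoSources : Prop := ∀ (x : Λ) (i : Fin k), (G.pathsInto x (Pi.single i 1)).Nonempty

theorem pathsInto_zero (x : Λ) : G.pathsInto x 0 = {path (𝟙 x)} := by
  ext ⟨y, z, f⟩
  simp only [pathsInto, d, Set.mem_ofPred_eq, Set.mem_singleton_iff]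
  constructor
  · rintro ⟨rfl, h⟩
    have := (G.factorisation f 0 0 (by simpa using h)).unique
      (y₁ := ⟨y, f, 𝟙 y⟩) (y₂ := ⟨z, 𝟙 z, f⟩)
      ⟨h, G.deg_id _, by simp⟩ ⟨G.deg_id _, h, by simp⟩
    have hyz : y = z := congrArg Sigma.fst this
    subst hyz
    simp only [Sigma.mk.injEq, heq_eq_eq, true_and, Prod.mk.injEq] at this
    rw [this.1]
  · rintro h
    cases h
    exact ⟨rfl, G.deg_id _⟩

theorem finite_pathsInto (hG : G.RowFinite) (m : Fin k → ℕ) (x : Λ) :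
    (G.pathsInto x m).Finite := by
  have h0 : ∀ x, (G.pathsInto x 0).Finite := fun x => by
    rw [pathsInto_zero]; exact Set.finite_singleton _
  have hadd : ∀ m n : Fin k → ℕ, (∀ x, (G.pathsInto x m).Finite) →
      (∀ x, (G.pathsInto x n).Finite) → ∀ x, (G.pathsInto x (m + n)).Finite := by
    intro m n hm hn x
    refine ((hm x).biUnion fun μ _ => (hn μ.left).image fun ν =>
      open Classical in
      if h : ν.right = μ.left then path ((ν.hom ≫ eqToHom h) ≫ μ.hom) else μ).subset ?_
    rintro ⟨y, z, f⟩ ⟨rfl, h⟩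
    obtain ⟨⟨w, a, b⟩, ⟨ha, hb, hab⟩, -⟩ := G.factorisation f m n h
    simp only [Set.mem_iUnion]
    refine ⟨path a, ⟨rfl, ha⟩, path b, ⟨rfl, hb⟩, ?_⟩
    simpa using hab
  have hsum : ∀ x, (G.pathsInto x (∑ i, Pi.single i (m i))).Finite := by
    refine Finset.sum_induction _ (fun m => ∀ x, (G.pathsInto x m).Finite) hadd h0 ?_
    intro i _
    induction m i with
    | zero => simpa using h0
    | succ n ih => rw [Pi.single_add]; exact hadd _ _ ih fun x => hG x i
  simpa [Finset.univ_sum_single] using hsum x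

/-- `σ` is a segment of `l` from `p` to `q`: `l = l'σl''` with `d(l') = p`, `d(σ) = q - p` and
`d(l'') = d(l) - q`. -/
def IsSegment (l : Path Λ) (p q : Fin k → ℕ) (σ : Path Λ) : Prop :=
  ∃ (l' : σ.right ⟶ l.right) (l'' : l.left ⟶ σ.left),
    G.deg l' = p ∧ G.d σ = q - p ∧ G.deg l'' = G.d l - q ∧ l'' ≫ σ.hom ≫ l' = l.hom

theorem existsUnique_isSegment (l : Path Λ) {p q : Fin k → ℕ} (hpq : p ≤ q) (hq : q ≤ G.d l) :
    ∃! σ : Path Λ, G.IsSegment l p q σ := by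
  obtain ⟨x, y, f⟩ := l
  change q ≤ G.deg f at hq
  have e1 : G.deg f = p + ((q - p) + (G.deg f - q)) := by
    rw [← add_assoc, add_tsub_cancel_of_le hpq, add_tsub_cancel_of_le hq]
  obtain ⟨⟨w, a, b⟩, ⟨ha, hb, hab⟩, hu⟩ := G.factorisation f _ _ e1
  obtain ⟨⟨z, c, e⟩, ⟨hc, he, hce⟩, hu'⟩ := G.factorisation b _ _ hb
  dsimp only at ha hb hab hc he hce
  refine ⟨path c, ⟨a, e, ha, hc, he, ?_⟩, ?_⟩
  · rw [← Category.assoc]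
    exact (congrArg (· ≫ a) hce).trans hab
  · rintro ⟨z', w', c'⟩ ⟨a', e', ha', hc', he', h⟩
    simp only [d] at hc' he' h a' e'
    have h1 := hu ⟨w', a', e' ≫ c'⟩ ⟨ha', by rw [G.deg_comp, hc', he'], by simpa using h⟩
    have hw : w' = w := congrArg Sigma.fst h1
    subst hw
    simp only [Sigma.mk.injEq, heq_eq_eq, true_and, Prod.mk.injEq] at h1
    have h2 := hu' ⟨z', c', e'⟩ ⟨hc', he', h1.2⟩
    have hz : z' = z := congrArg Sigma.fst h2
    subst hz
    simp only [Sigma.mk.injEq, heq_eq_eq, true_and, Prod.mk.injEq] at h2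
    rw [h2.1]

/-- The segment `l(p, q)` of a path `l`, for `p ≤ q ≤ d(l)`. -/
noncomputable def segment (l : Path Λ) (p q : Fin k → ℕ) (hpq : p ≤ q) (hq : q ≤ G.d l) :
    Path Λ :=
  (G.existsUnique_isSegment l hpq hq).choose

theorem isSegment_segment (l : Path Λ) (p q : Fin k → ℕ) (hpq : p ≤ q) (hq : q ≤ G.d l) :
    G.IsSegment l p q (G.segment l p q hpq hq) :=
  (G.existsUnique_isSegment l hpq hq).choose_spec.1

theorem add_sub_sup_le {m n D : Fin k → ℕ} (h : m ⊔ n ≤ D) : m + (D - (m ⊔ n)) ≤ D := by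
  intro i
  have := h i
  simp only [Pi.add_apply, Pi.sub_apply, Pi.sup_apply] at this ⊢
  omega

theorem add_sub_sup_le' {m n D : Fin k → ℕ} (h : m ⊔ n ≤ D) : n + (D - (m ⊔ n)) ≤ D := by
  rw [sup_comm] at h ⊢
  exact add_sub_sup_le h

/-- For every vertex `v` and all `m ≠ n` there is a path `l` with range `v` and
`d(l) ≥ m ∨ n` such that
`l(m, m + d(l) - (m ∨ n)) ≠ l(n, n + d(l) - (m ∨ n))`. -/
def Aperiodic : Prop :=
  ∀ (x : Λ) (m n : Fin k → ℕ), m ≠ n →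
    ∃ (l : Path Λ) (h : m ⊔ n ≤ G.d l), l.right = x ∧
      G.segment l m (m + (G.d l - (m ⊔ n))) le_self_add (add_sub_sup_le h) ≠
        G.segment l n (n + (G.d l - (m ⊔ n))) le_self_add (add_sub_sup_le' h)

/-- A Cuntz–Krieger family of a row-finite `k`-graph in a C⋆-algebra `B`; the projection `t_v` of
a vertex `v` is the element of the family at the identity of `v`. -/
structure IsCuntzKriegerFamily {B : Type*} [NonUnitalCStarAlgebra B] (hG : G.RowFinite)
    (t : Path Λ → B) : Prop where
  partialIsometry : ∀ l : Path Λ, t l * star (t l) * t l = t l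
  isStarProjection : ∀ x : Λ, IsStarProjection (t (path (𝟙 x)))
  orthogonal : ∀ x y : Λ, x ≠ y → t (path (𝟙 x)) * t (path (𝟙 y)) = 0
  comp : ∀ {x y z : Λ} (μ : y ⟶ z) (ν : x ⟶ y), t (path (ν ≫ μ)) = t (path μ) * t (path ν)
  star_mul_self : ∀ l : Path Λ, star (t l) * t l = t (path (𝟙 l.left))
  sum_eq : ∀ (x : Λ) (m : Fin k → ℕ),
    t (path (𝟙 x)) = ∑ l ∈ (G.finite_pathsInto hG m x).toFinset, t l * star (t l)

end KGraph

/-! Compressing the sum by a suitable projection `Q` kills its off-diagonal terms and keeps the norm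
of its diagonal part. Let `N` be the join of the degrees of the paths in `F`. By (CK4) the diagonal
part is a combination of elements `t_σ t_τ^*` with `d(σ) = d(τ) = N`. These vanish unless `σ` and
`τ` have the same source, and for each vertex `v` those with source `v` are matrix units; different
vertices give orthogonal blocks, so one block carries the norm (`exists_norm_le_block`).

For that `v`, aperiodicity yields a path `l` with range `v` such that `αl` and `βl` have orthogonal
ranges for all relevant distinct degrees of `α` and `β` (`exists_separating_finset`). Let `Q` be the
sum of the range projections of the paths `σl`, with `σ` in the block. Compression by `Q` turns the
matrix units `t_σ t_τ^*` into `t_{σl} t_{τl}^*`, again nonzero matrix units, so the norm of the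
block is kept (`norm_sum_smul_mul_star_congr`). It annihilates every `t_μ t_ν^*` with `d(μ) ≠ d(ν)`
(`compression_eq_zero`). Since `‖Q‖ ≤ 1`, the inequality follows. -/

section CStar

/-! ### Orthogonal sums and matrix units in C⋆-algebras -/

variable {B : Type*} [NonUnitalCStarAlgebra B]

/-- A pairwise orthogonal finite sum in a C⋆-algebra has the norm of one of its terms. -/
theorem exists_norm_sum_le_of_orthogonal {ι : Type*} (s : Finset ι) (hs : s.Nonempty) (f : ι → B)
    (h1 : ∀ i ∈ s, ∀ j ∈ s, i ≠ j → star (f i) * f j = 0)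
    (h2 : ∀ i ∈ s, ∀ j ∈ s, i ≠ j → f i * star (f j) = 0) :
    ∃ i ∈ s, ‖∑ j ∈ s, f j‖ ≤ ‖f i‖ := by
  classical
  have hstar : star (∑ j ∈ s, f j) * (∑ j ∈ s, f j) = ∑ j ∈ s, star (f j) * f j := by
    rw [star_sum, Finset.sum_mul_sum]
    refine Finset.sum_congr rfl fun i hi => ?_
    exact Finset.sum_eq_single_of_mem i hi fun j hj hji => h1 i hi j hj hji.symm
  -- Extending by zero outside `s` gives the orthogonality for all pairs of indices that
  -- `IsSelfAdjoint.nnnorm_sum_eq_sup` requires.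
  set g : ι → B := fun j => if j ∈ s then star (f j) * f j else 0 with hg
  have hsum : ∑ j ∈ s, star (f j) * f j = ∑ j ∈ s, g j :=
    Finset.sum_congr rfl fun j hj => by simp [hg, hj]
  have hsup := IsSelfAdjoint.nnnorm_sum_eq_sup (f := g) s
    (fun i hi => by
      simp only [hg, if_pos hi]
      exact IsSelfAdjoint.star_mul_self _)
    (fun i j hij => by
      simp only [hg, Function.onFun]
      split_ifs with hi hj
      · rw [mul_assoc, ← mul_assoc (f i), h2 i hi j hj hij, zero_mul, mul_zero]
      all_goals simp)
  obtain ⟨i, hi, hmax⟩ := Finset.exists_mem_eq_sup s hs (fun j => ‖g j‖₊)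
  refine ⟨i, hi, ?_⟩
  have h3 : ‖∑ j ∈ s, f j‖ * ‖∑ j ∈ s, f j‖ = ‖f i‖ * ‖f i‖ := by
    rw [← CStarRing.norm_star_mul_self, ← CStarRing.norm_star_mul_self, hstar, hsum]
    have := congrArg NNReal.toReal (hsup.trans hmax)
    simpa [hg, hi] using this
  exact le_of_eq ((mul_self_inj (norm_nonneg _) (norm_nonneg _)).1 h3)

/-- If a finite sum of projections acts as a unit on one of them, then that projection is orthogonal
to the others. -/
theorem mul_eq_zero_of_sum_mul_eq {ι : Type*} (s : Finset ι) (p : ι → B)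
    (hp : ∀ i ∈ s, IsStarProjection (p i)) {i j : ι} (hi : i ∈ s) (hj : j ∈ s) (hij : j ≠ i)
    (hs : (∑ l ∈ s, p l) * p i = p i) : p j * p i = 0 := by
  classical
  let _ := CStarAlgebra.spectralOrder B
  have _ := CStarAlgebra.spectralOrderedRing B
  -- Compressing `hs` by `p i` leaves a vanishing sum of the positive elements `(p l * p i)^* (p l *
  -- p i)` over `l ≠ i`, so each is zero.
  have hq : ∀ l ∈ s, p i * (p l * p i) = star (p l * p i) * (p l * p i) := fun l hl => by
    rw [star_mul, (hp l hl).isSelfAdjoint.star_eq, (hp i hi).isSelfAdjoint.star_eq, mul_assoc,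
      ← mul_assoc (p l) (p l), (hp l hl).isIdempotentElem.eq]
  have hsum : ∑ l ∈ s.erase i, p i * (p l * p i) = 0 := by
    have h := congrArg (p i * ·) hs
    simp only [Finset.sum_mul, Finset.mul_sum, (hp i hi).isIdempotentElem.eq] at h
    rw [← Finset.add_sum_erase s _ hi, (hp i hi).isIdempotentElem.eq,
      (hp i hi).isIdempotentElem.eq] at h
    simpa using h
  have h0 := (Finset.sum_eq_zero_iff_of_nonneg fun l hl => by
    rw [hq l (Finset.mem_of_mem_erase hl)]; exact star_mul_self_nonneg _).1 hsum j
    (Finset.mem_erase.2 ⟨hij, hj⟩)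
  rw [hq j hj] at h0
  exact CStarRing.star_mul_self_eq_zero_iff _ |>.1 h0

/-- The homomorphism from a matrix algebra given by a system of partial isometries with the same
initial projection and orthogonal ranges. -/
noncomputable def matrixUnitsHom {ι : Type*} [Fintype ι] [DecidableEq ι] (x : ι → B) {p : B}
    (hx : ∀ i j, star (x i) * x j = if i = j then p else 0)
    (hxp : ∀ i, x i * p = x i) : Matrix ι ι ℂ →⋆ₙₐ[ℂ] B where
  toFun c := ∑ i, ∑ j, c i j • (x i * star (x j))
  map_smul' r c := by simp [Finset.smul_sum, smul_smul]
  map_zero' := by simp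
  map_add' c c' := by simp [add_smul, Finset.sum_add_distrib]
  map_mul' c c' := by
    have hmul : ∀ i j k l, (x i * star (x j)) * (x k * star (x l)) =
        if j = k then x i * star (x l) else 0 := fun i j k l => by
      rw [mul_assoc, ← mul_assoc (star (x j)), hx]
      split_ifs
      · rw [← mul_assoc, hxp]
      · simp
    rw [Finset.sum_mul]
    refine Finset.sum_congr rfl fun i _ => ?_
    simp only [Finset.sum_mul, Matrix.mul_apply, Finset.sum_smul]
    rw [Finset.sum_comm]
    refine Finset.sum_congr rfl fun l _ => ?_
    simp only [Finset.mul_sum, smul_mul_smul_comm, hmul]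
    rw [Finset.sum_comm]
    exact Finset.sum_congr rfl fun j _ => by simp
  map_star' c := by
    simp only [star_sum, star_smul, star_mul, star_star, Matrix.star_apply]
    exact Finset.sum_comm

open scoped Matrix.Norms.L2Operator in
/-- Linear combinations of matrix units in a C⋆-algebra have the norm of their matrix of
coefficients. -/
theorem norm_sum_smul_mul_star {ι : Type*} [Fintype ι] [DecidableEq ι] (x : ι → B) {p : B}
    (hp : p ≠ 0) (hx : ∀ i j, star (x i) * x j = if i = j then p else 0)
    (hxp : ∀ i, x i * p = x i) (c : Matrix ι ι ℂ) :
    ‖∑ i, ∑ j, c i j • (x i * star (x j))‖ = ‖c‖ := by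
  -- An injective star homomorphism of C⋆-algebras is isometric. For injectivity, `star (x i) * b *
  -- x j` isolates `c i j • p`.
  refine NonUnitalStarAlgHom.norm_map (matrixUnitsHom x hx hxp) ?_ c
  refine (injective_iff_map_eq_zero _).2 fun c hc => ?_
  ext i j
  change ∑ k, ∑ l, c k l • (x k * star (x l)) = 0 at hc
  have h := congrArg (fun b => star (x i) * b * x j) hc
  have hmul : ∀ k l, star (x i) * (x k * star (x l)) * x j =
      if i = k then if l = j then p else 0 else 0 := fun k l => by
    have hpp : p * p = p := by
      have h1 := hx i i
      rw [if_pos rfl] at h1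
      calc p * p = star (x i) * x i * p := by rw [h1]
        _ = p := by rw [mul_assoc, hxp, h1]
    rw [← mul_assoc, mul_assoc, hx, hx]
    split_ifs <;> simp [hpp]
  simp only [Finset.sum_mul, Finset.mul_sum, mul_smul_comm, smul_mul_assoc, hmul, smul_ite, smul_zero,
    mul_zero, zero_mul, Finset.sum_ite_eq, Finset.sum_ite_eq', Finset.mem_univ, if_true,
    Finset.sum_ite_irrel, Finset.sum_const_zero] at h
  simpa [hp] using h

/-- Systems of partial isometries with orthogonal ranges and a common nonzero initial projection
give linear combinations of matrix units with the same norm. -/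
theorem norm_sum_smul_mul_star_congr {ι : Type*} (s : Finset ι) (x y : ι → B) {p q : B}
    (hp : p ≠ 0) (hx : ∀ i ∈ s, star (x i) * x i = p)
    (hx0 : ∀ i ∈ s, ∀ j ∈ s, i ≠ j → star (x i) * x j = 0) (hxp : ∀ i ∈ s, x i * p = x i)
    (hq : q ≠ 0) (hy : ∀ i ∈ s, star (y i) * y i = q)
    (hy0 : ∀ i ∈ s, ∀ j ∈ s, i ≠ j → star (y i) * y j = 0) (hyq : ∀ i ∈ s, y i * q = y i)
    (c : ι → ι → ℂ) :
    ‖∑ i ∈ s, ∑ j ∈ s, c i j • (x i * star (x j))‖ =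
      ‖∑ i ∈ s, ∑ j ∈ s, c i j • (y i * star (y j))‖ := by
  classical
  have h1 := norm_sum_smul_mul_star (fun i : s => x i) hp (fun i j => by
    split_ifs with h
    · rw [h]; exact hx j j.2
    · exact hx0 i i.2 j j.2 fun hij => h (Subtype.ext hij)) (fun i => hxp i i.2)
    (fun i j => c i j)
  have h2 := norm_sum_smul_mul_star (fun i : s => y i) hq (fun i j => by
    split_ifs with h
    · rw [h]; exact hy j j.2
    · exact hy0 i i.2 j j.2 fun hij => h (Subtype.ext hij)) (fun i => hyq i i.2)
    (fun i j => c i j)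
  have h3 := h1.trans h2.symm
  simp only [Finset.univ_eq_attach] at h3
  rw [← Finset.sum_attach s, ← Finset.sum_attach s (fun i => ∑ j ∈ s, c i j • (y i * star (y j)))]
  simp only [← Finset.sum_attach s (fun j => c _ j • (x _ * star (x j))),
    ← Finset.sum_attach s (fun j => c _ j • (y _ * star (y j)))]
  exact h3

end CStar

/-! ### Orthogonality of ranges and separating paths -/

namespace KGraph

variable {k : ℕ} {Λ : Type u} [Category.{v} Λ] (G : KGraph k Λ)

/-- Two factorisations of a path with the same degrees agree. -/
theorem path_eq_of_comp_eq {x y w w' : Λ} {f : w ⟶ y} {g : x ⟶ w} {f' : w' ⟶ y} {g' : x ⟶ w'}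
    (hf : G.deg f = G.deg f') (hg : G.deg g = G.deg g') (h : g ≫ f = g' ≫ f') :
    path f = path f' ∧ path g = path g' := by
  have := (G.factorisation (g' ≫ f') _ _ (G.deg_comp g' f')).unique
    (y₁ := ⟨w, f, g⟩) (y₂ := ⟨w', f', g'⟩) ⟨hf, hg, h⟩ ⟨rfl, rfl, rfl⟩
  have hw : w = w' := congrArg Sigma.fst this
  subst hw
  simp only [Sigma.mk.injEq, heq_eq_eq, true_and, Prod.mk.injEq] at this
  rw [this.1, this.2]
  exact ⟨rfl, rfl⟩

variable {G} {B : Type*} [NonUnitalCStarAlgebra B] {hG : G.RowFinite} {t : Path Λ → B}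

namespace IsCuntzKriegerFamily

theorem mul_source (ht : G.IsCuntzKriegerFamily hG t) (l : Path Λ) :
    t l * t (path (𝟙 l.left)) = t l := by
  simpa using (ht.comp l.hom (𝟙 _)).symm

theorem range_mul (ht : G.IsCuntzKriegerFamily hG t) (l : Path Λ) :
    t (path (𝟙 l.right)) * t l = t l := by
  simpa using (ht.comp (𝟙 _) l.hom).symm

theorem source_mul_star (ht : G.IsCuntzKriegerFamily hG t) (l : Path Λ) :
    t (path (𝟙 l.left)) * star (t l) = star (t l) := by
  rw [← (ht.isStarProjection l.left).isSelfAdjoint.star_eq, ← star_mul, ht.mul_source]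

theorem star_mul_range (ht : G.IsCuntzKriegerFamily hG t) (l : Path Λ) :
    star (t l) * t (path (𝟙 l.right)) = star (t l) := by
  rw [← (ht.isStarProjection l.right).isSelfAdjoint.star_eq, ← star_mul, ht.range_mul]

theorem mul_star_eq_zero (ht : G.IsCuntzKriegerFamily hG t) {l l' : Path Λ}
    (h : l.left ≠ l'.left) : t l * star (t l') = 0 := by
  rw [← ht.mul_source l, ← ht.source_mul_star l', mul_assoc, ← mul_assoc (t (path (𝟙 l.left))),
    ht.orthogonal _ _ h, zero_mul, mul_zero]

theorem isStarProjection_mul_star (ht : G.IsCuntzKriegerFamily hG t) (l : Path Λ) :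
    IsStarProjection (t l * star (t l)) where
  isIdempotentElem := by rw [IsIdempotentElem, ← mul_assoc, ht.partialIsometry]
  isSelfAdjoint := IsSelfAdjoint.mul_star_self _

/-- Distinct paths of the same degree have orthogonal range projections. -/
theorem star_mul_eq_zero (ht : G.IsCuntzKriegerFamily hG t) {l l' : Path Λ}
    (hd : G.d l = G.d l') (h : l ≠ l') : star (t l) * t l' = 0 := by
  by_cases hr : l.right = l'.right
  · have hproj : (t l * star (t l)) * (t l' * star (t l')) = 0 := by
      refine mul_eq_zero_of_sum_mul_eq (G.finite_pathsInto hG (G.d l') l'.right).toFinset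
        (fun l => t l * star (t l)) (fun l _ => ht.isStarProjection_mul_star l) ?_ ?_ h ?_
      · simp [pathsInto]
      · simp [pathsInto, hr, hd]
      · rw [← ht.sum_eq, ← mul_assoc, ht.range_mul]
    calc star (t l) * t l' = star (t l * star (t l) * t l) * (t l' * star (t l') * t l') := by
          rw [ht.partialIsometry, ht.partialIsometry]
      _ = star (t l) * ((t l * star (t l)) * (t l' * star (t l'))) * t l' := by
          simp only [star_mul, star_star, mul_assoc]
      _ = 0 := by rw [hproj, mul_zero, zero_mul]
  · rw [← ht.star_mul_range l, ← ht.range_mul l', mul_assoc, ← mul_assoc (t (path (𝟙 l.right))),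
      ht.orthogonal _ _ hr, zero_mul, mul_zero]

/-- Paths with different initial segments of the same degree have orthogonal ranges. -/
theorem star_comp_mul_comp_eq_zero (ht : G.IsCuntzKriegerFamily hG t) {w x y w' x' y' : Λ}
    {f : x ⟶ y} {g : w ⟶ x} {f' : x' ⟶ y'} {g' : w' ⟶ x'} (hd : G.deg f = G.deg f')
    (h : path f ≠ path f') : star (t (path (g ≫ f))) * t (path (g' ≫ f')) = 0 := by
  rw [ht.comp, ht.comp, star_mul, mul_assoc, ← mul_assoc (star (t (path f))),
    ht.star_mul_eq_zero (l := path f) (l' := path f') hd h, zero_mul, mul_zero]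

/-- In an aperiodic `k`-graph every vertex is the range of a path `l` such that `αl` and `βl` have
orthogonal ranges whenever `α` and `β` have the given distinct degrees. -/
theorem exists_separating (ht : G.IsCuntzKriegerFamily hG t) (haper : G.Aperiodic) (v : Λ)
    {m n : Fin k → ℕ} (hmn : m ≠ n) : ∃ (x : Λ) (l : x ⟶ v), ∀ (y z : Λ) (α : v ⟶ y) (β : v ⟶ z),
      G.deg α = m → G.deg β = n → star (t (path (l ≫ α))) * t (path (l ≫ β)) = 0 := by
  obtain ⟨⟨x, w, l⟩, h, hr, hne⟩ := haper v m n hmn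
  dsimp only at hr
  subst hr
  refine ⟨x, l, fun y z α β hα hβ => ?_⟩
  have h1 := G.isSegment_segment ⟨x, w, l⟩ m _ le_self_add (add_sub_sup_le h)
  have h2 := G.isSegment_segment ⟨x, w, l⟩ n _ le_self_add (add_sub_sup_le' h)
  generalize G.segment ⟨x, w, l⟩ m _ _ _ = σ at h1 hne
  generalize G.segment ⟨x, w, l⟩ n _ _ _ = τ at h2 hne
  obtain ⟨y1, z1, σ⟩ := σ
  obtain ⟨y2, z2, τ⟩ := τ
  obtain ⟨a, b, ha, hσ, -, hab⟩ := h1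
  obtain ⟨a', b', ha', hτ, -, hab'⟩ := h2
  simp only [d, add_tsub_cancel_left] at a b a' b' ha hσ hab ha' hτ hab'
  -- The factorisations of `l` are used crosswise: at `n` behind `α` of degree `m`, and at `m`
  -- behind `β` of degree `n`. Both segments then start at degree `m + n`, so equal initial segments
  -- of `αl` and `βl` would force `σ = τ`.
  have e1 : l ≫ α = b' ≫ (τ ≫ a' ≫ α) := by simp [← hab']
  have e2 : l ≫ β = b ≫ (σ ≫ a ≫ β) := by simp [← hab]
  rw [e1, e2]
  refine ht.star_comp_mul_comp_eq_zero ?_ fun heq => hne ?_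
  · simp only [G.deg_comp, hα, hβ, ha, hσ, ha', hτ, add_comm m n]
  · have hy : y = z := congrArg Quiver.Total.right heq
    subst hy
    have hx : y2 = y1 := congrArg Quiver.Total.left heq
    subst hx
    have heq' : τ ≫ a' ≫ α = σ ≫ a ≫ β := by simpa using heq
    exact (G.path_eq_of_comp_eq (by simp only [G.deg_comp, hα, hβ, ha, ha', add_comm m n])
      (hτ.trans hσ.symm) heq').2.symm

/-- The path of `exists_separating` can be chosen for finitely many pairs of degrees at once. -/
theorem exists_separating_finset (ht : G.IsCuntzKriegerFamily hG t) (haper : G.Aperiodic) (v : Λ)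
    (D : Finset ((Fin k → ℕ) × (Fin k → ℕ))) :
    ∃ (x : Λ) (l : x ⟶ v), ∀ (y z : Λ) (α : v ⟶ y) (β : v ⟶ z),
      (G.deg α, G.deg β) ∈ D → G.deg α ≠ G.deg β →
        star (t (path (l ≫ α))) * t (path (l ≫ β)) = 0 := by
  classical
  induction D using Finset.induction_on with
  | empty => exact ⟨v, 𝟙 v, by simp⟩
  | insert p D _ ih =>
    obtain ⟨x, l, hl⟩ := ih
    by_cases hp : p.1 = p.2
    · refine ⟨x, l, fun y z α β hD hne => hl y z α β ?_ hne⟩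
      refine (Finset.mem_insert.1 hD).resolve_left fun h => hne ?_
      rw [← h] at hp
      exact hp
    -- The new path has to separate `αl` from `βl`, hence the shift by `G.deg l`. Extending `l`
    -- preserves the orthogonality already obtained.
    · obtain ⟨w, l', hl'⟩ := ht.exists_separating haper x
        (m := p.1 + G.deg l) (n := p.2 + G.deg l) (by simpa using hp)
      refine ⟨w, l' ≫ l, fun y z α β hD hne => ?_⟩
      simp only [Category.assoc]
      rcases Finset.mem_insert.1 hD with h | h
      · exact hl' y z _ _ (by rw [G.deg_comp, ← h]) (by rw [G.deg_comp, ← h])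
      · rw [ht.comp (l ≫ α), ht.comp (l ≫ β), star_mul, mul_assoc, ← mul_assoc (star (t (path (l ≫ α)))),
          hl y z α β h hne, zero_mul, mul_zero]

end IsCuntzKriegerFamily
end KGraph

/-! ### Expansion in degree `N`, compressions and blocks -/

namespace KGraph

variable {k : ℕ} {Λ : Type u} [Category.{v} Λ] {G : KGraph k Λ}
  {B : Type*} [NonUnitalCStarAlgebra B] {hG : G.RowFinite} {t : Path Λ → B}

namespace IsCuntzKriegerFamily

/-- If `d(μ) = d(ν) ≤ N`, then `t_μ t_ν^*` is a linear combination of the elements `t_σ t_τ^*` with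
`d(σ) = d(τ) = N`. -/
theorem mul_star_mem_span (ht : G.IsCuntzKriegerFamily hG t) {N : Fin k → ℕ}
    {S : Finset (Path Λ)} {μ ν : Path Λ} (hμ : ∀ l : Path Λ, l.right = μ.right → G.d l = N → l ∈ S)
    (hν : ∀ l : Path Λ, l.right = ν.right → G.d l = N → l ∈ S)
    (hd : G.d μ = G.d ν) (hN : G.d μ ≤ N) :
    t μ * star (t ν) ∈
      Submodule.span ℂ (Set.range fun p : S × S => t p.1 * star (t p.2)) := by
  by_cases h : μ.left = ν.left
  · obtain ⟨x, y, μ⟩ := μ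
    obtain ⟨x', z, ν⟩ := ν
    dsimp only at h hμ hν
    subst h
    simp only [d] at hd hN
    rw [← ht.mul_source ⟨x, y, μ⟩, ht.sum_eq x (N - G.deg μ), Finset.mul_sum, Finset.sum_mul]
    refine Submodule.sum_mem _ fun α hα => ?_
    obtain ⟨w, x', α⟩ := α
    simp only [Set.Finite.mem_toFinset, pathsInto, Set.mem_ofPred_eq, d] at hα
    obtain ⟨rfl, hα⟩ := hα
    refine Submodule.subset_span ⟨(⟨path (α ≫ μ), hμ _ rfl ?_⟩, ⟨path (α ≫ ν), hν _ rfl ?_⟩), ?_⟩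
    · simp only [d, G.deg_comp, hα, add_tsub_cancel_of_le hN]
    · simp only [d, G.deg_comp, hα, ← hd, add_tsub_cancel_of_le hN]
    · simp only [ht.comp, star_mul, mul_assoc]
  · rw [ht.mul_star_eq_zero h]
    exact Submodule.zero_mem _

/-- The product `t_σ^* t_μ` for `d(μ) ≤ d(σ)`. -/
theorem star_mul_eq (ht : G.IsCuntzKriegerFamily hG t) {v : Λ} (σ : Path Λ) (hσ : σ.left = v)
    (μ : Path Λ) (h : G.d μ ≤ G.d σ) :
    star (t σ) * t μ = 0 ∨ ∃ σ' : v ⟶ μ.left, G.deg σ' = G.d σ - G.d μ ∧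
      star (t σ) * t μ = star (t (path σ')) := by
  obtain ⟨x, y, σ⟩ := σ
  dsimp only at hσ
  subst hσ
  -- The initial segment of `σ` of degree `d(μ)` is either `μ`, leaving the adjoint of the
  -- remainder, or has range orthogonal to that of `μ`.
  obtain ⟨⟨w, μ', σ'⟩, ⟨hμ, hσ, rfl⟩, -⟩ := G.factorisation σ (G.d μ) (G.d ⟨x, y, σ⟩ - G.d μ)
    (add_tsub_cancel_of_le h).symm
  dsimp only at hμ hσ h ⊢
  rw [ht.comp, star_mul, mul_assoc]
  by_cases hne : path μ' = μ
  · subst hne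
    refine Or.inr ⟨σ', hσ, ?_⟩
    rw [ht.star_mul_self]
    exact ht.star_mul_range (path σ')
  · left
    rw [ht.star_mul_eq_zero (l := path μ') hμ hne, mul_zero]

/-- If `l` separates the degrees `d(σ) - d(μ)` and `d(τ) - d(ν)`, then the compression of
`t_μ t_ν^*` to the range projections of `σl` and `τl` vanishes. -/
theorem compression_eq_zero (ht : G.IsCuntzKriegerFamily hG t) {x v : Λ} {l : x ⟶ v}
    {N : Fin k → ℕ} {μ ν σ τ : Path Λ}
    (hl : ∀ (y z : Λ) (α : v ⟶ y) (β : v ⟶ z), G.deg α = N - G.d μ → G.deg β = N - G.d ν →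
      star (t (path (l ≫ α))) * t (path (l ≫ β)) = 0)
    (hμ : G.d μ ≤ N) (hν : G.d ν ≤ N) (hσ : σ.left = v) (hτ : τ.left = v)
    (hσN : G.d σ = N) (hτN : G.d τ = N) :
    star (t σ * t (path l)) * (t μ * star (t ν)) * (t τ * t (path l)) = 0 := by
  have e : star (t σ * t (path l)) * (t μ * star (t ν)) * (t τ * t (path l)) =
      star (t (path l)) * (star (t σ) * t μ) * star (star (t τ) * t ν) * t (path l) := by
    simp only [star_mul, star_star, mul_assoc]
  rw [e]
  rcases ht.star_mul_eq σ hσ μ (hσN ▸ hμ) with h | ⟨α, hα, h⟩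
  · simp [h]
  rcases ht.star_mul_eq τ hτ ν (hτN ▸ hν) with h' | ⟨β, hβ, h'⟩
  · simp [h']
  have := hl _ _ α β (by rw [hα, hσN]) (by rw [hβ, hτN])
  rw [ht.comp, ht.comp, star_mul] at this
  rw [h, h', star_star, mul_assoc, this]

/-- A linear combination of the elements `t_σ t_τ^*`, for `σ` and `τ` of the same degree, has the
norm of its part belonging to some vertex. -/
theorem exists_norm_le_block (ht : G.IsCuntzKriegerFamily hG t) [DecidableEq Λ] {N : Fin k → ℕ}
    {S : Finset (Path Λ)} (hne : S.Nonempty) (hS : ∀ l ∈ S, G.d l = N) (c : Path Λ → Path Λ → ℂ) :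
    ∃ v : Λ, ‖∑ σ ∈ S, ∑ τ ∈ S, c σ τ • (t σ * star (t τ))‖ ≤
      ‖∑ σ ∈ S with σ.left = v, ∑ τ ∈ S with τ.left = v, c σ τ • (t σ * star (t τ))‖ := by
  have h0 : ∀ σ ∈ S, ∀ τ ∈ S, σ.left ≠ τ.left → star (t σ) * t τ = 0 := fun σ hσ τ hτ h =>
    ht.star_mul_eq_zero ((hS σ hσ).trans (hS τ hτ).symm) fun e => h (e ▸ rfl)
  obtain ⟨v, -, hv⟩ := exists_norm_sum_le_of_orthogonal (S.image Quiver.Total.left) (hne.image _)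
    (fun v => ∑ σ ∈ S with σ.left = v, ∑ τ ∈ S with τ.left = v, c σ τ • (t σ * star (t τ)))
    (fun v _ w _ hvw => by
      simp only [star_sum, star_smul, star_mul, star_star, Finset.sum_mul, Finset.mul_sum]
      refine Finset.sum_eq_zero fun σ hσ => Finset.sum_eq_zero fun τ hτ =>
        Finset.sum_eq_zero fun σ' hσ' => Finset.sum_eq_zero fun τ' hτ' => ?_
      simp only [Finset.mem_filter] at hσ hτ hσ' hτ'
      rw [smul_mul_smul_comm, mul_assoc, ← mul_assoc (star (t σ')),
        h0 σ' hσ'.1 σ hσ.1 (by rw [hσ'.2, hσ.2]; exact hvw), zero_mul, mul_zero, smul_zero])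
    (fun v _ w _ hvw => by
      simp only [star_sum, star_smul, star_mul, star_star, Finset.sum_mul, Finset.mul_sum]
      refine Finset.sum_eq_zero fun σ hσ => Finset.sum_eq_zero fun τ hτ =>
        Finset.sum_eq_zero fun σ' hσ' => Finset.sum_eq_zero fun τ' hτ' => ?_
      simp only [Finset.mem_filter] at hσ hτ hσ' hτ'
      rw [smul_mul_smul_comm, mul_assoc, ← mul_assoc (star (t τ')),
        h0 τ' hτ'.1 τ hτ.1 (by rw [hτ'.2, hτ.2]; exact hvw), zero_mul, mul_zero, smul_zero])
  refine ⟨v, le_of_eq_of_le (congrArg norm ?_) hv⟩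
  rw [← Finset.sum_fiberwise_of_maps_to (g := Quiver.Total.left)
    (fun σ hσ => Finset.mem_image_of_mem _ hσ)]
  refine Finset.sum_congr rfl fun v _ => Finset.sum_congr rfl fun σ hσ => ?_
  refine (Finset.sum_filter_of_ne fun τ _ hne => ?_).symm
  by_contra h
  refine hne ?_
  rw [ht.mul_star_eq_zero (by rw [(Finset.mem_filter.1 hσ).2]; exact Ne.symm h), smul_zero]

end IsCuntzKriegerFamily
end KGraph

/-! ### The norm inequality -/

theorem mainTheorem9 {k : ℕ} {Λ : Type u} [Category.{v} Λ] (G : KGraph k Λ)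
    (hrow : G.RowFinite) (hsrc : G.NoSources) (haper : G.Aperiodic)
    {B : Type*} [NonUnitalCStarAlgebra B] (t : KGraph.Path Λ → B)
    (ht : G.IsCuntzKriegerFamily hrow t) (hne : ∀ x : Λ, t (KGraph.path (𝟙 x)) ≠ 0)
    (F : Finset (KGraph.Path Λ)) (a : KGraph.Path Λ → KGraph.Path Λ → ℂ)
    (ha : ∀ μ ∈ F, ∀ ν ∈ F, a μ ν ≠ 0 → μ.left = ν.left) :
    ‖∑ μ ∈ F, ∑ ν ∈ F with G.d μ = G.d ν, a μ ν • (t μ * star (t ν))‖ ≤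
      ‖∑ μ ∈ F, ∑ ν ∈ F, a μ ν • (t μ * star (t ν))‖ := by
  classical
  set N : Fin k → ℕ := F.sup G.d with hN
  have hFN : ∀ μ ∈ F, G.d μ ≤ N := fun μ hμ => Finset.le_sup hμ
  set S : Finset (KGraph.Path Λ) :=
    F.biUnion fun μ => (G.finite_pathsInto hrow N μ.right).toFinset with hSdef
  have hSN : ∀ l ∈ S, G.d l = N := fun l hl => by
    simp only [hSdef, Finset.mem_biUnion, Set.Finite.mem_toFinset] at hl
    obtain ⟨μ, _, _, h⟩ := hl
    exact h
  have hSF : ∀ μ ∈ F, ∀ l : KGraph.Path Λ, l.right = μ.right → G.d l = N → l ∈ S :=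
    fun μ hμ l hr hl => Finset.mem_biUnion.2 ⟨μ, hμ, (Set.Finite.mem_toFinset _).2 ⟨hr, hl⟩⟩
  -- the diagonal part is a combination of elements given by paths of degree `N`
  have hspan : ∑ μ ∈ F, ∑ ν ∈ F with G.d μ = G.d ν, a μ ν • (t μ * star (t ν)) ∈
      Submodule.span ℂ (Set.range fun p : S × S => t p.1 * star (t p.2)) := by
    refine Submodule.sum_mem _ fun μ hμ => Submodule.sum_mem _ fun ν hν => ?_
    obtain ⟨hν, hd⟩ := Finset.mem_filter.1 hν
    exact Submodule.smul_mem _ _ (ht.mul_star_mem_span (hSF μ hμ) (hSF ν hν) hd (hFN μ hμ))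
  obtain ⟨c, hc⟩ : ∃ c : KGraph.Path Λ → KGraph.Path Λ → ℂ,
      ∑ μ ∈ F, ∑ ν ∈ F with G.d μ = G.d ν, a μ ν • (t μ * star (t ν)) =
        ∑ σ ∈ S, ∑ τ ∈ S, c σ τ • (t σ * star (t τ)) := by
    obtain ⟨c, hc⟩ := (Submodule.mem_span_range_iff_exists_fun ℂ).1 hspan
    refine ⟨fun σ τ => if h : σ ∈ S ∧ τ ∈ S then c (⟨σ, h.1⟩, ⟨τ, h.2⟩) else 0, ?_⟩
    rw [← hc, Fintype.sum_prod_type, Finset.univ_eq_attach, ← Finset.sum_attach S]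
    refine Finset.sum_congr rfl fun σ _ => ?_
    rw [← Finset.sum_attach S]
    exact Finset.sum_congr rfl fun τ _ => by simp
  rcases S.eq_empty_or_nonempty with hS | hS
  · rw [hc, hS]
    simp
  obtain ⟨v, hv⟩ := ht.exists_norm_le_block hS hSN c
  -- `N - d(μ)` is the degree of the remainder of a path of degree `N` that starts with `μ`.
  obtain ⟨x, l, hl⟩ := ht.exists_separating_finset haper v
    ((F ×ˢ F).image fun p => (N - G.d p.1, N - G.d p.2))
  -- compression to the range projections of the paths `σl`
  set T : Finset (KGraph.Path Λ) := {σ ∈ S | σ.left = v} with hT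
  have hTS : ∀ σ ∈ T, σ ∈ S ∧ σ.left = v := fun σ hσ => Finset.mem_filter.1 hσ
  set y : KGraph.Path Λ → B := fun σ => t σ * t (KGraph.path l) with hy
  have h0 : ∀ σ ∈ S, ∀ τ ∈ S, σ ≠ τ → star (t σ) * t τ = 0 := fun σ hσ τ hτ h =>
    ht.star_mul_eq_zero ((hSN σ hσ).trans (hSN τ hτ).symm) h
  have h1 : ∀ σ ∈ T, star (t σ) * t σ = t (KGraph.path (𝟙 v)) := fun σ hσ => by
    rw [ht.star_mul_self, (hTS σ hσ).2]
  have hyt0 : ∀ σ ∈ T, ∀ τ ∈ S, σ ≠ τ → star (y σ) * t τ = 0 := fun σ hσ τ hτ h => by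
    rw [hy, star_mul, mul_assoc, h0 σ (hTS σ hσ).1 τ hτ h, mul_zero]
  have hyt : ∀ σ ∈ T, star (y σ) * t σ = star (t (KGraph.path l)) := fun σ hσ => by
    rw [hy, star_mul, mul_assoc, h1 σ hσ]
    exact ht.star_mul_range (KGraph.path l)
  have hyy0 : ∀ σ ∈ T, ∀ τ ∈ T, σ ≠ τ → star (y σ) * y τ = 0 := fun σ hσ τ hτ h => by
    change star (y σ) * (t τ * _) = 0
    rw [← mul_assoc, hyt0 σ hσ τ (hTS τ hτ).1 h, zero_mul]
  have hyy : ∀ σ ∈ T, star (y σ) * y σ = t (KGraph.path (𝟙 x)) := fun σ hσ => by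
    change star (y σ) * (t σ * _) = _
    rw [← mul_assoc, hyt σ hσ, ht.star_mul_self]
  have hyx : ∀ σ, y σ * t (KGraph.path (𝟙 x)) = y σ := fun σ => by
    rw [hy, mul_assoc]
    exact congrArg (t σ * ·) (ht.mul_source (KGraph.path l))
  set Q : B := ∑ σ ∈ T, y σ * star (y σ) with hQ
  have hQt : ∀ σ ∈ T, Q * t σ = y σ * star (t (KGraph.path l)) := fun σ hσ => by
    rw [hQ, Finset.sum_mul, Finset.sum_eq_single_of_mem σ hσ fun τ hτ h => by
      rw [mul_assoc, hyt0 τ hτ σ (hTS σ hσ).1 h, mul_zero], mul_assoc, hyt σ hσ]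
  have hQt0 : ∀ σ ∈ S, σ ∉ T → Q * t σ = 0 := fun σ hσ h => by
    rw [hQ, Finset.sum_mul]
    refine Finset.sum_eq_zero fun τ hτ => ?_
    rw [mul_assoc, hyt0 τ hτ σ hσ fun e => h (e ▸ hτ), mul_zero]
  have hQproj : IsStarProjection Q := by
    have hsa : IsSelfAdjoint Q := by
      rw [IsSelfAdjoint, hQ, star_sum]
      simp
    refine ⟨?_, hsa⟩
    change Q * Q = Q
    nth_rw 2 [hQ]
    rw [Finset.mul_sum]
    refine Finset.sum_congr rfl fun σ hσ => ?_
    change Q * (t σ * _ * _) = _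
    rw [← mul_assoc, ← mul_assoc, hQt σ hσ, mul_assoc (y σ), ht.star_mul_self, hyx]
  have hcomp : Q * (∑ σ ∈ S, ∑ τ ∈ S, c σ τ • (t σ * star (t τ))) * Q =
      ∑ σ ∈ T, ∑ τ ∈ T, c σ τ • (y σ * star (y τ)) := by
    have hterm : ∀ σ τ, Q * (t σ * star (t τ)) * Q = (Q * t σ) * star (Q * t τ) := fun σ τ => by
      rw [star_mul, hQproj.isSelfAdjoint.star_eq]
      simp only [mul_assoc]
    simp only [Finset.mul_sum, Finset.sum_mul, mul_smul_comm, smul_mul_assoc, hterm]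
    rw [← Finset.sum_subset (Finset.filter_subset _ S) fun σ hσ h =>
      Finset.sum_eq_zero fun τ _ => by rw [hQt0 σ hσ h, zero_mul, smul_zero]]
    refine Finset.sum_congr rfl fun σ hσ => ?_
    rw [← Finset.sum_subset (Finset.filter_subset _ S) fun τ hτ h => by
      rw [hQt0 τ hτ h, star_zero, mul_zero, smul_zero]]
    refine Finset.sum_congr rfl fun τ hτ => ?_
    rw [hQt σ hσ, hQt τ hτ, star_mul, star_star, mul_assoc, ← mul_assoc (star (t _)),
      ht.star_mul_self, ← mul_assoc, hyx]
  -- As `N` dominates both degrees, the truncated subtraction from `N` keeps them distinct.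
  have hzero : ∀ μ ∈ F, ∀ ν ∈ F, G.d μ ≠ G.d ν → Q * (t μ * star (t ν)) * Q = 0 := fun μ hμ ν hν hd => by
    have hsub : N - G.d μ ≠ N - G.d ν := fun h => hd <| by
      rw [← tsub_tsub_cancel_of_le (hFN μ hμ), h, tsub_tsub_cancel_of_le (hFN ν hν)]
    rw [hQ, Finset.sum_mul, Finset.sum_mul_sum]
    refine Finset.sum_eq_zero fun σ hσ => Finset.sum_eq_zero fun τ hτ => ?_
    have h := ht.compression_eq_zero (l := l) (fun w z α β hα hβ => hl w z α β
      (Finset.mem_image.2 ⟨(μ, ν), Finset.mk_mem_product hμ hν, by rw [hα, hβ]⟩)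
      (by rw [hα, hβ]; exact hsub)) (hFN μ hμ) (hFN ν hν) (hTS σ hσ).2 (hTS τ hτ).2
      (hSN σ (hTS σ hσ).1) (hSN τ (hTS τ hτ).1)
    change star (y σ) * _ * y τ = 0 at h
    rw [mul_assoc (y σ), mul_assoc (y σ), ← mul_assoc _ (y τ), h, zero_mul, mul_zero]
  have hQb : Q * (∑ μ ∈ F, ∑ ν ∈ F, a μ ν • (t μ * star (t ν))) * Q =
      Q * (∑ μ ∈ F, ∑ ν ∈ F with G.d μ = G.d ν, a μ ν • (t μ * star (t ν))) * Q := by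
    simp only [Finset.mul_sum, Finset.sum_mul]
    refine Finset.sum_congr rfl fun μ hμ => ?_
    refine (Finset.sum_filter_of_ne fun ν hν hne => ?_).symm
    by_contra h
    refine hne ?_
    rw [mul_smul_comm, smul_mul_assoc, hzero μ hμ ν hν h, smul_zero]
  calc _ ≤ ‖∑ σ ∈ T, ∑ τ ∈ T, c σ τ • (t σ * star (t τ))‖ := hc ▸ hv
    _ = ‖∑ σ ∈ T, ∑ τ ∈ T, c σ τ • (y σ * star (y τ))‖ :=
      norm_sum_smul_mul_star_congr T t y (hne v) h1
        (fun σ hσ τ hτ => h0 σ (hTS σ hσ).1 τ (hTS τ hτ).1)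
        (fun σ hσ => by rw [← (hTS σ hσ).2, ht.mul_source]) (hne x) hyy hyy0 (fun σ _ => hyx σ) c
    _ = ‖Q * (∑ μ ∈ F, ∑ ν ∈ F, a μ ν • (t μ * star (t ν))) * Q‖ := by rw [hQb, hc, hcomp]
    _ ≤ ‖Q‖ * ‖∑ μ ∈ F, ∑ ν ∈ F, a μ ν • (t μ * star (t ν))‖ * ‖Q‖ :=
      (norm_mul_le _ _).trans (mul_le_mul_of_nonneg_right (norm_mul_le _ _) (norm_nonneg _))
    _ ≤ 1 * ‖∑ μ ∈ F, ∑ ν ∈ F, a μ ν • (t μ * star (t ν))‖ * 1 := by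
      gcongr <;> exact hQproj.norm_le
    _ = _ := by rw [one_mul, mul_one]
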